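/- Theorem 2 (genie-aided DMT upper bound for the opportunistic shared relay channel). Consider $n\ge 1$ source-destination pairs and one relay. Source $i$ is connected to destination $i$ by a coefficient $h_{ii}$, to the relay by $h_{ir}$, and the relay is connected to destination $i$ by $h_{ri}$; there are no links between a source and the destination of another pair. All coefficients are i.i.d. $\mathcal{CN}(0,1)$, constant during a transmission interval of $\ell$ channel uses, and known to the receivers and to the mode selection (knowledge at the transmitters is also allowed); the noise at each destination is i.i.d. $\mathcal{CN}(0,1)$, and every codeword of each source and of the relay has average power at most $\rho$. A genie gives the relay the source messages for free. In each interval one of $n+1$ access modes is selected as a (possibly randomized) function of the channel coefficients: for $1\le i\le n$, the relay-assisted mode $i$, in which only source $i$ and the relay transmit, so that destination $i$ receives $h_{ii}x_i+h_{ri}x_r+w_i$, where both codewords $x_i,x_r$ may depend on the message of source $i$; and the non-relayed mode, in which all sources transmit and the relay is silent, so that destination $i$ receives $h_{ii}x_i+w_i$ for each $i$, and an error occurs if at least one destination decodes wrongly. A family of schemes indexed by $\rho$ (with block lengths $\ell=\ell(\rho)$ that may depend on $\rho$) has multiplexing gain $r$ if, as $\rho\to\infty$, the rate of the active source in each relay-assisted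 mode divided by $\log\rho$ tends to $r$, the rate of each source in the non-relayed mode divided by $\log\rho$ tends to $r/n$, and all these rates are bounded below by a positive constant for large $\rho$ (automatic if $r>0$). Let $P_e(\rho)$ be the resulting error probability, averaged over messages, noise, fading and selection; the diversity gain of the family is $-\lim_{\rho\to\infty}\log P_e(\rho)/\log\rho$ (taken as $\limsup_{\rho\to\infty}\bigl(-\log P_e(\rho)/\log\rho\bigr)$ if the limit does not exist), and the DMT $d(r)$ is the supremum of the diversity gains of all families with multiplexing gain $r$. Then, for every $r\ge 0$, $$d(r)\le\Bigl(1-\frac rn\Bigr)^+ +(2n-1)(1-r)^+ ,$$ and the right-hand side equals $2n-\bigl(2n-1+\frac1n\bigr)r$ for $0\le r\le 1$ and $1-\frac rn$ for $1<r\le n$. -/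

import Mathlib

open MeasureTheory ProbabilityTheory Filter Topology
open scoped NNReal ENNReal

namespace SharedRelay

noncomputable section

/-- The circularly symmetric complex Gaussian law `CN(0,1)`: independent real and imaginary
parts, each of variance `1/2`. -/
def complexGaussian : Measure ℂ :=
  ((gaussianReal 0 (1 / 2)).prod (gaussianReal 0 (1 / 2))).map
    Complex.measurableEquivRealProd.symm

/-- Signals of one transmission interval of `ℓ` channel uses. -/
abbrev Signal (ℓ : ℕ) : Type := Fin ℓ → ℂ

/-- The noise of one destination: `ℓ` independent `CN(0,1)` variables. -/
def noise (ℓ : ℕ) : Measure (Signal ℓ) := Measure.pi fun _ => complexGaussian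

/-- The channel coefficients of the shared relay channel with `n` source-destination pairs:
`(direct, relay to destination, source to relay)`, each indexed by the pairs.
There are no links between a source and the destination of another pair. -/
abbrev ChannelState (n : ℕ) : Type := (Fin n → ℂ) × (Fin n → ℂ) × (Fin n → ℂ)

/-- The coefficient from source `i` to destination `i`. -/
def ChannelState.direct {n : ℕ} (h : ChannelState n) (i : Fin n) : ℂ := h.1 i

/-- The coefficient from the relay to destination `i`. -/
def ChannelState.relayDest {n : ℕ} (h : ChannelState n) (i : Fin n) : ℂ := h.2.1 i

/-- The coefficient from source `i` to the relay. -/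
def ChannelState.sourceRelay {n : ℕ} (h : ChannelState n) (i : Fin n) : ℂ := h.2.2 i

/-- Rayleigh fading: all channel coefficients are independent `CN(0,1)`. -/
def fading (n : ℕ) : Measure (ChannelState n) :=
  (Measure.pi fun _ => complexGaussian).prod
    ((Measure.pi fun _ => complexGaussian).prod (Measure.pi fun _ => complexGaussian))

/-- A codebook of `M` codewords of length `ℓ` for one transmitter, under the short-term average
power constraint `(1/ℓ) ∑ |x_t|² ≤ ρ` on every codeword. The codebook may depend on the channel
state (a code without channel knowledge at the transmitter is a constant function of it). -/
structure Codebook (n ℓ M : ℕ) (ρ : ℝ≥0) where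
  word : ChannelState n → Fin M → Signal ℓ
  measurable_word : ∀ m, Measurable fun h => word h m
  power : ∀ h m, ∑ t, ‖word h m t‖ ^ 2 ≤ (ℓ : ℝ) * ρ

/-- A decoder at a destination that knows the channel state. -/
structure Decoder (n ℓ M : ℕ) where
  decode : ChannelState n × Signal ℓ → Fin M
  measurable_decode : Measurable decode

/-- A code for the genie-aided relay-assisted mode in which a single source is active. The genie
lets the codeword sent by the relay depend on the source message itself, during the whole
transmission interval. -/
structure RelayedCode (n ℓ : ℕ) (ρ : ℝ≥0) where
  M : ℕ
  source : Codebook n ℓ M ρ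
  relay : Codebook n ℓ M ρ
  decoder : Decoder n ℓ M

/-- A code for one of the links of the non-relayed mode. -/
structure DirectCode (n ℓ : ℕ) (ρ : ℝ≥0) where
  M : ℕ
  source : Codebook n ℓ M ρ
  decoder : Decoder n ℓ M

/-- The access modes: `some i` is the relay-assisted mode in which source `i` and the relay are
active, `none` is the non-relayed mode in which all sources are active and the relay is silent. -/
abbrev Mode (n : ℕ) : Type := Option (Fin n)

/-- A scheme for the genie-aided opportunistic shared relay channel at signal-to-noise ratio `ρ`:
a block length, a code for every access mode, and a (possibly randomized) selection of the access
mode based on the channel state. -/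
structure Scheme (n : ℕ) (ρ : ℝ≥0) where
  ℓ : ℕ
  ℓ_pos : 0 < ℓ
  relayed : Fin n → RelayedCode n ℓ ρ
  direct : Fin n → DirectCode n ℓ ρ
  select : ChannelState n → PMF (Mode n)
  measurable_select : ∀ k, Measurable fun h => select h k

/-- The error probability of relay-assisted mode `i` in channel state `h`, for a uniformly
distributed message. -/
def RelayedCode.error {n ℓ : ℕ} {ρ : ℝ≥0} (C : RelayedCode n ℓ ρ) (i : Fin n)
    (h : ChannelState n) : ℝ≥0∞ :=
  (C.M : ℝ≥0∞)⁻¹ * ∑ m : Fin C.M, noise ℓ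
    {w | C.decoder.decode
      (h, h.direct i • C.source.word h m + h.relayDest i • C.relay.word h m + w) ≠ m}

/-- The error probability of the non-relayed mode in channel state `h`: the messages are
independent and uniformly distributed, the noises at the destinations are independent, and an
error occurs if at least one destination fails to decode the message of its source. -/
def directError {n ℓ : ℕ} {ρ : ℝ≥0} (C : Fin n → DirectCode n ℓ ρ)
    (h : ChannelState n) : ℝ≥0∞ :=
  (∏ i, ((C i).M : ℝ≥0∞))⁻¹ * ∑ m : (∀ i, Fin (C i).M), (Measure.pi fun _ : Fin n => noise ℓ)
    {w | ∃ i, (C i).decoder.decode (h, h.direct i • (C i).source.word h (m i) + w i) ≠ m i}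

/-- The error probability of an access mode in channel state `h`. -/
def Scheme.modeError {n : ℕ} {ρ : ℝ≥0} (S : Scheme n ρ) (h : ChannelState n) :
    Mode n → ℝ≥0∞
  | none => directError S.direct h
  | some i => (S.relayed i).error i h

/-- The overall error probability `P_e` of a scheme, with opportunistic mode selection. -/
def Scheme.errorProb {n : ℕ} {ρ : ℝ≥0} (S : Scheme n ρ) : ℝ≥0∞ :=
  ∫⁻ h, ∑ k : Mode n, S.select h k * S.modeError h k ∂(fading n)

/-- The rate of the active source in relay-assisted mode `i`. -/
def Scheme.relayedRate {n : ℕ} {ρ : ℝ≥0} (S : Scheme n ρ) (i : Fin n) : ℝ :=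
  Real.log (S.relayed i).M / S.ℓ

/-- The rate of source `i` in the non-relayed mode. -/
def Scheme.directRate {n : ℕ} {ρ : ℝ≥0} (S : Scheme n ρ) (i : Fin n) : ℝ :=
  Real.log (S.direct i).M / S.ℓ

/-- A family of schemes, one for each `ρ`, has (sum) multiplexing gain `r`: in every relay-assisted
mode the active source transmits at a rate `∼ r log ρ`, in the non-relayed mode every source
transmits at a rate `∼ (r / n) log ρ`. The rates are bounded away from zero, which only matters
for `r = 0`. -/
structure HasMultiplexingGain {n : ℕ} (S : ∀ ρ : ℝ≥0, Scheme n ρ) (r : ℝ) : Prop where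
  relayed : ∀ i, Tendsto (fun ρ => (S ρ).relayedRate i / Real.log ρ) atTop (𝓝 r)
  direct : ∀ i, Tendsto (fun ρ => (S ρ).directRate i / Real.log ρ) atTop (𝓝 (r / n))
  rate_pos : ∃ R₀ : ℝ, 0 < R₀ ∧
    ∀ᶠ ρ in atTop, ∀ i, R₀ ≤ (S ρ).relayedRate i ∧ R₀ ≤ (S ρ).directRate i

/-- The diversity gain `- lim log P_e / log ρ` of a family of schemes. The upper limit is used, so
that no family is excluded from an upper bound because the limit does not exist. -/
def diversityGain {n : ℕ} (S : ∀ ρ : ℝ≥0, Scheme n ρ) : EReal :=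
  limsup (fun ρ : ℝ≥0 => -(S ρ).errorProb.log / (Real.log ρ : EReal)) atTop

/-- The diversity-multiplexing tradeoff of the genie-aided opportunistic shared relay channel with
`n` pairs: the largest diversity gain of a family of schemes with multiplexing gain `r`. -/
def genieDMT (n : ℕ) (r : ℝ) : EReal :=
  sSup {d | ∃ S : ∀ ρ : ℝ≥0, Scheme n ρ, HasMultiplexingGain S r ∧ d = diversityGain S}

end

end SharedRelay

/-!
The genie-aided mode `i` is a MISO link, and a link at signal-to-noise ratio `S` cannot carry a rate
above `log (1 + S)`. Hence all `n + 1` access modes fail together when the channel is so weak that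
every mode is in outage: every `|h_ii|²` and `|h_ri|²` is below `ρ ^ (-a)` with `a` slightly above
`(1 - r)⁺` (the relay-assisted modes), and one of the direct gains is even below `ρ ^ (-b)` with
`b` slightly above `(1 - r / n)⁺` (the non-relayed mode, which fails as soon as one link does). A
complex Gaussian coefficient has power gain at most `δ` with probability of order `δ`, so this
event has probability of order `ρ ^ (-(b + (2 n - 1) a))`, and no mode selection helps on it
(`HasMultiplexingGain.eventually_le_errorProb`).

The converse for one link has to hold uniformly over all block lengths, including bounded ones, and
for rates that stay bounded when `r = 0`. It comes from comparing the output densities `p_m` of the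
messages with the density `q` of Gaussian noise of variance `1 + S`: since
`p_m ≤ (λ q + p_m² / (λ q)) / 2`, summing over the decision regions and optimizing `λ` bounds the
probability of correct decoding by `√(V / M)`, where `V` is the largest `∫ p_m² / q`
(`sum_noise_real_le`). Completing the square gives `V ≤ exp (ℓ * affinityExponent S)`, where
`affinityExponent S` exceeds `log (1 + S)` by at most `min 1 (2 S)`. This excess is negligible
against a rate that grows like `log ρ`, and also when `S → 0`
(`eventually_affinityExponent_add_le`).
-/

namespace SharedRelay

/-! ### Complex Gaussian densities and the chi-square affinity -/

/-- The density `z ↦ (a / π) exp (-a |z|²)` of the circularly symmetric complex Gaussian law of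
variance `1 / a`. -/
noncomputable def gaussianDensity (a : ℝ) (z : ℂ) : ℝ := a / Real.pi * Real.exp (-a * ‖z‖ ^ 2)

lemma gaussianDensity_pos {a : ℝ} (ha : 0 < a) (z : ℂ) : 0 < gaussianDensity a z := by
  unfold gaussianDensity; positivity

lemma continuous_gaussianDensity (a : ℝ) : Continuous (gaussianDensity a) := by
  unfold gaussianDensity; fun_prop

lemma integral_exp_neg_mul_sq_norm {b : ℝ} (hb : 0 < b) :
    ∫ z : ℂ, Real.exp (-b * ‖z‖ ^ 2) = Real.pi / b := by
  have h := GaussianFourier.integral_rexp_neg_mul_sq_norm (V := ℂ) hb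
  simpa [Complex.finrank_real_complex] using h

lemma integrable_exp_neg_mul_sq_norm {b : ℝ} (hb : 0 < b) :
    Integrable fun z : ℂ => Real.exp (-b * ‖z‖ ^ 2) := by
  by_contra h
  have h' := integral_exp_neg_mul_sq_norm hb
  rw [integral_undef h] at h'
  have : 0 < Real.pi / b := by positivity
  linarith

lemma integrable_gaussianDensity {a : ℝ} (ha : 0 < a) : Integrable (gaussianDensity a) :=
  (integrable_exp_neg_mul_sq_norm ha).const_mul _

lemma integral_gaussianDensity {a : ℝ} (ha : 0 < a) : ∫ z, gaussianDensity a z = 1 := by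
  unfold gaussianDensity
  rw [integral_const_mul, integral_exp_neg_mul_sq_norm ha]
  have := Real.pi_pos
  field_simp

lemma complexGaussian_eq_withDensity :
    complexGaussian = volume.withDensity fun z => ENNReal.ofReal (gaussianDensity 1 z) := by
  have hv : (1 / 2 : ℝ≥0) ≠ 0 := by norm_num
  unfold complexGaussian
  rw [gaussianReal_of_var_ne_zero _ hv,
    prod_withDensity (measurable_gaussianPDF _ _) (measurable_gaussianPDF _ _)]
  have hvol := Complex.volume_preserving_equiv_real_prod.symm Complex.measurableEquivRealProd
  ext s hs
  rw [Measure.map_apply (MeasurableEquiv.measurable _) hs,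
    withDensity_apply _ (MeasurableEquiv.measurable _ hs), withDensity_apply _ hs,
    ← hvol.setLIntegral_comp_preimage_emb (MeasurableEquiv.measurableEmbedding _)]
  refine lintegral_congr fun p => ?_
  unfold gaussianPDF
  rw [← ENNReal.ofReal_mul (gaussianPDFReal_nonneg _ _ _)]
  congr 1
  have hn : ‖Complex.measurableEquivRealProd.symm p‖ ^ 2 = p.1 ^ 2 + p.2 ^ 2 := by
    rw [Complex.sq_norm, Complex.normSq_apply]
    simp [Complex.measurableEquivRealProd, sq]
  rw [gaussianDensity, hn, gaussianPDFReal, gaussianPDFReal, mul_mul_mul_comm, ← Real.exp_add]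
  have hpi := Real.pi_pos
  have hsqrt : √(2 * Real.pi * ((1 / 2 : ℝ≥0) : ℝ)) * √(2 * Real.pi * ((1 / 2 : ℝ≥0) : ℝ))
      = Real.pi := by
    rw [Real.mul_self_sqrt (by positivity)]; push_cast; ring
  rw [← mul_inv, hsqrt, inv_eq_one_div]
  congr 2
  rw [show ((1 / 2 : ℝ≥0) : ℝ) = 1 / 2 by push_cast; rfl]
  ring

instance : IsProbabilityMeasure complexGaussian := by
  unfold complexGaussian
  exact Measure.isProbabilityMeasure_map (MeasurableEquiv.measurable _).aemeasurable

instance (ℓ : ℕ) : IsProbabilityMeasure (noise ℓ) := by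
  unfold noise; infer_instance

/-- A small disc carries probability of the order of its area. -/
lemma le_complexGaussian_closedBall {δ : ℝ} (h0 : 0 ≤ δ) (h1 : δ ≤ 1) :
    ENNReal.ofReal (δ / Real.exp 1) ≤ complexGaussian (Metric.closedBall 0 √δ) := by
  rw [complexGaussian_eq_withDensity, withDensity_apply _ Metric.isClosed_closedBall.measurableSet]
  calc ENNReal.ofReal (δ / Real.exp 1)
      = ∫⁻ _ in Metric.closedBall (0 : ℂ) √δ, ENNReal.ofReal (1 / Real.pi * Real.exp (-1)) := by
        have hpi : (NNReal.pi : ℝ≥0∞) = ENNReal.ofReal Real.pi := by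
          rw [← NNReal.coe_real_pi, ENNReal.ofReal_coe_nnreal]
        rw [setLIntegral_const, Complex.volume_closedBall, ← ENNReal.ofReal_pow (by positivity),
          Real.sq_sqrt h0, hpi, ← ENNReal.ofReal_mul h0, ← ENNReal.ofReal_mul (by positivity)]
        congr 1
        have := Real.pi_pos
        rw [Real.exp_neg]
        field_simp
    _ ≤ _ := by
        refine setLIntegral_mono' Metric.isClosed_closedBall.measurableSet fun z hz => ?_
        refine ENNReal.ofReal_le_ofReal ?_
        unfold gaussianDensity
        gcongr
        rw [mem_closedBall_zero_iff] at hz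
        have : ‖z‖ ^ 2 ≤ δ := by
          rw [← Real.sq_sqrt h0]; gcongr
        linarith

/-- The density of `ℓ` independent complex Gaussian variables of variance `1 / a`, centred at the
entries of `s`. -/
noncomputable def signalDensity {ℓ : ℕ} (a : ℝ) (s y : Signal ℓ) : ℝ :=
  ∏ t, gaussianDensity a (y t - s t)

lemma signalDensity_pos {ℓ : ℕ} {a : ℝ} (ha : 0 < a) (s y : Signal ℓ) :
    0 < signalDensity a s y :=
  Finset.prod_pos fun _ _ => gaussianDensity_pos ha _

lemma integrable_signalDensity {ℓ : ℕ} {a : ℝ} (ha : 0 < a) (s : Signal ℓ) :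
    Integrable (signalDensity a s) :=
  Integrable.fintype_prod (f := fun t z => gaussianDensity a (z - s t)) fun t =>
    (integrable_gaussianDensity ha).comp_sub_right (s t)

lemma integral_signalDensity {ℓ : ℕ} {a : ℝ} (ha : 0 < a) (s : Signal ℓ) :
    ∫ y, signalDensity a s y = 1 := by
  unfold signalDensity
  rw [integral_fintype_prod_volume_eq_prod fun t z => gaussianDensity a (z - s t)]
  refine Finset.prod_eq_one fun t _ => ?_
  rw [integral_sub_right_eq_self (gaussianDensity a), integral_gaussianDensity ha]

lemma noise_eq_withDensity (ℓ : ℕ) :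
    noise ℓ = volume.withDensity fun y => ENNReal.ofReal (signalDensity 1 0 y) := by
  unfold noise
  refine (Measure.pi_eq fun s hs => ?_)
  have hint : ∀ t : Fin ℓ, Integrable (gaussianDensity 1) (volume.restrict (s t)) := fun t =>
    (integrable_gaussianDensity one_pos).restrict
  have hnn : ∀ z, 0 ≤ gaussianDensity 1 z := fun z => (gaussianDensity_pos one_pos z).le
  rw [withDensity_apply _ (MeasurableSet.univ_pi hs), volume_pi, Measure.restrict_pi_pi,
    ← ofReal_integral_eq_lintegral_ofReal]
  · simp only [signalDensity, Pi.zero_apply, sub_zero]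
    rw [integral_fintype_prod_eq_prod fun _ z => gaussianDensity 1 z,
      ENNReal.ofReal_prod_of_nonneg fun t _ => integral_nonneg hnn]
    refine Finset.prod_congr rfl fun t _ => ?_
    rw [complexGaussian_eq_withDensity, withDensity_apply _ (hs t),
      ofReal_integral_eq_lintegral_ofReal (hint t) (ae_of_all _ hnn)]
  · unfold signalDensity
    simpa using Integrable.fintype_prod hint
  · exact ae_of_all _ fun y => (signalDensity_pos one_pos 0 y).le

lemma noise_real_preimage_add {ℓ : ℕ} (s : Signal ℓ) {D : Set (Signal ℓ)} (hD : MeasurableSet D) :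
    (noise ℓ).real {w | s + w ∈ D} = ∫ y in D, signalDensity 1 s y := by
  have hpre : MeasurableSet {w : Signal ℓ | s + w ∈ D} := (measurable_const_add s) hD
  have hnn := fun y : Signal ℓ => (signalDensity_pos one_pos 0 y).le
  rw [noise_eq_withDensity, Measure.real, withDensity_apply _ hpre,
    ← ofReal_integral_eq_lintegral_ofReal (integrable_signalDensity one_pos 0).restrict
      (ae_of_all _ hnn), ENNReal.toReal_ofReal (integral_nonneg hnn), ← integral_indicator hpre,
    ← integral_indicator hD, ← integral_add_left_eq_self (D.indicator _) s]
  refine integral_congr_ae (ae_of_all _ fun w => ?_)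
  simp [Set.indicator, signalDensity]

lemma integrable_sq_div_gaussianDensity_and_integral {a : ℝ} (h0 : 0 < a) (h1 : a ≤ 1) (s : ℂ) :
    Integrable (fun z => gaussianDensity 1 (z - s) ^ 2 / gaussianDensity a z) ∧
      ∫ z, gaussianDensity 1 (z - s) ^ 2 / gaussianDensity a z =
        (a * (2 - a))⁻¹ * Real.exp (2 * a / (2 - a) * ‖s‖ ^ 2) := by
  have h2 : 0 < 2 - a := by linarith
  have hpi := Real.pi_pos
  -- completing the square around `2 s / (2 - a)`
  have key : (fun z => gaussianDensity 1 (z - s) ^ 2 / gaussianDensity a z) = fun z =>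
      (Real.pi * a)⁻¹ * Real.exp (2 * a / (2 - a) * ‖s‖ ^ 2) *
        Real.exp (-(2 - a) * ‖z - (2 / (2 - a) : ℝ) • s‖ ^ 2) := by
    funext z
    have hexp : (2 : ℕ) * (-1 * ‖z - s‖ ^ 2) - -a * ‖z‖ ^ 2 = 2 * a / (2 - a) * ‖s‖ ^ 2 +
        -(2 - a) * ‖z - (2 / (2 - a) : ℝ) • s‖ ^ 2 := by
      simp only [Complex.sq_norm, Complex.normSq_apply, Complex.sub_re, Complex.sub_im,
        Complex.smul_re, Complex.smul_im, smul_eq_mul]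
      field_simp
      ring
    unfold gaussianDensity
    rw [mul_assoc, ← Real.exp_add, ← hexp, Real.exp_sub, Real.exp_nat_mul]
    field_simp
  rw [key]
  refine ⟨((integrable_exp_neg_mul_sq_norm h2).comp_sub_right _).const_mul _, ?_⟩
  rw [integral_const_mul, integral_sub_right_eq_self fun z : ℂ => Real.exp (-(2 - a) * ‖z‖ ^ 2),
    integral_exp_neg_mul_sq_norm h2]
  field_simp

/-- The exponent per channel use in the bound on the chi-square affinity between the output of a
channel with signal-to-noise ratio `S` and Gaussian noise of variance `1 + S`. It exceeds the
capacity `log (1 + S)` by at most `min 1 (2 S)`. -/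
noncomputable def affinityExponent (S : ℝ) : ℝ := Real.log (1 + S) + 2 * S / (1 + 2 * S)

/-- The chi-square affinity between the output for a signal of average power at most `S` and
Gaussian noise of variance `1 + S` is exponential in the block length. -/
lemma integral_sq_div_signalDensity_le {ℓ : ℕ} {S : ℝ} (hS : 0 ≤ S) {s : Signal ℓ}
    (hs : ∑ t, ‖s t‖ ^ 2 ≤ ℓ * S) :
    Integrable (fun y => signalDensity 1 s y ^ 2 / signalDensity (1 + S)⁻¹ 0 y) ∧
      ∫ y, signalDensity 1 s y ^ 2 / signalDensity (1 + S)⁻¹ 0 y ≤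
        Real.exp (ℓ * affinityExponent S) := by
  have h0 : 0 < (1 + S)⁻¹ := by positivity
  have h1 : (1 + S)⁻¹ ≤ 1 := inv_le_one_of_one_le₀ (by linarith)
  have hfun : (fun y : Signal ℓ => signalDensity 1 s y ^ 2 / signalDensity (1 + S)⁻¹ 0 y) =
      fun y => ∏ t, gaussianDensity 1 (y t - s t) ^ 2 / gaussianDensity (1 + S)⁻¹ (y t) := by
    funext y
    simp [signalDensity, Finset.prod_div_distrib, Finset.prod_pow]
  rw [hfun]
  refine ⟨Integrable.fintype_prod
    (f := fun t z => gaussianDensity 1 (z - s t) ^ 2 / gaussianDensity (1 + S)⁻¹ z)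
    fun t => (integrable_sq_div_gaussianDensity_and_integral h0 h1 (s t)).1, ?_⟩
  rw [integral_fintype_prod_volume_eq_prod
    fun t z => gaussianDensity 1 (z - s t) ^ 2 / gaussianDensity (1 + S)⁻¹ z]
  simp_rw [(integrable_sq_div_gaussianDensity_and_integral h0 h1 _).2]
  rw [Finset.prod_mul_distrib, ← Real.exp_sum, ← Finset.mul_sum, Finset.prod_const,
    Finset.card_univ, Fintype.card_fin]
  have hc : 2 * (1 + S)⁻¹ / (2 - (1 + S)⁻¹) = 2 / (1 + 2 * S) := by
    have : 2 - (1 + S)⁻¹ = (1 + 2 * S) / (1 + S) := by field_simp; ring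
    rw [this]; field_simp
  have hp : ((1 + S)⁻¹ * (2 - (1 + S)⁻¹))⁻¹ ≤ Real.exp (Real.log (1 + S)) := by
    rw [Real.exp_log (by positivity)]
    have : (1 + S)⁻¹ * (2 - (1 + S)⁻¹) = (1 + 2 * S) / (1 + S) ^ 2 := by field_simp; ring
    rw [this, inv_div, div_le_iff₀ (by positivity)]
    nlinarith
  calc _ ≤ Real.exp (Real.log (1 + S)) ^ ℓ * Real.exp (2 / (1 + 2 * S) * (ℓ * S)) := by
        rw [hc]; gcongr
        have : 0 < 2 - (1 + S)⁻¹ := by linarith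
        positivity
    _ = _ := by
        rw [← Real.exp_nat_mul, ← Real.exp_add, affinityExponent]
        congr 1; field_simp

/-! ### Converse for one link, uniform in the block length -/

/-- Converse for one link over all block lengths: the probability that any decoder recovers one of
`M` signals of average power at most `S` is at most the square root of the affinity divided by
`M`. -/
lemma sum_noise_real_le {ℓ M : ℕ} {S : ℝ} (hS : 0 ≤ S) {s : Fin M → Signal ℓ}
    (hs : ∀ m, ∑ t, ‖s m t‖ ^ 2 ≤ ℓ * S) {dec : Signal ℓ → Fin M} (hdec : Measurable dec) :
    ∑ m, (noise ℓ).real {w | dec (s m + w) = m} ≤ √(M * Real.exp (ℓ * affinityExponent S)) := by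
  rcases Nat.eq_zero_or_pos M with rfl | hM
  · simp
  set V := Real.exp (ℓ * affinityExponent S)
  have hVpos : 0 < V := Real.exp_pos _
  have hMpos : (0 : ℝ) < M := by exact_mod_cast hM
  -- the weight that balances the two terms of the AM-GM bound on the densities
  set lam := √(M * V)
  have hlampos : 0 < lam := Real.sqrt_pos.2 (by positivity)
  have ha : 0 < (1 + S)⁻¹ := by positivity
  have hD : ∀ m, MeasurableSet (dec ⁻¹' {m}) := fun m => hdec (measurableSet_singleton m)
  set q : Signal ℓ → ℝ := signalDensity (1 + S)⁻¹ 0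
  have hqint : Integrable q := integrable_signalDensity ha 0
  have hterm : ∀ m, (noise ℓ).real {w | dec (s m + w) = m} ≤
      (lam * ∫ y in dec ⁻¹' {m}, q y) / 2 + V / lam / 2 := by
    intro m
    obtain ⟨hi, hle⟩ := integral_sq_div_signalDensity_le hS (hs m)
    have h1 : (noise ℓ).real {w | dec (s m + w) = m} =
        ∫ y in dec ⁻¹' {m}, signalDensity 1 (s m) y := noise_real_preimage_add (s m) (hD m)
    rw [h1]
    calc ∫ y in dec ⁻¹' {m}, signalDensity 1 (s m) y
        ≤ ∫ y in dec ⁻¹' {m}, (lam / 2 * q y +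
            (lam⁻¹ / 2) * (signalDensity 1 (s m) y ^ 2 / q y)) := by
          refine integral_mono (integrable_signalDensity one_pos _).restrict
            ((hqint.restrict.const_mul _).add (hi.restrict.const_mul _)) fun y => ?_
          have hqy : 0 < q y := signalDensity_pos ha 0 y
          have hid : lam / 2 * q y + lam⁻¹ / 2 * (signalDensity 1 (s m) y ^ 2 / q y) -
              signalDensity 1 (s m) y = (lam * q y - signalDensity 1 (s m) y) ^ 2 /
                (2 * lam * q y) := by
            field_simp; ring
          have : 0 ≤ (lam * q y - signalDensity 1 (s m) y) ^ 2 / (2 * lam * q y) := by positivity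
          change signalDensity 1 (s m) y ≤ _
          linarith
      _ = lam / 2 * (∫ y in dec ⁻¹' {m}, q y) +
            lam⁻¹ / 2 * ∫ y in dec ⁻¹' {m}, signalDensity 1 (s m) y ^ 2 / q y := by
          rw [integral_add (hqint.restrict.const_mul _) (hi.restrict.const_mul _),
            integral_const_mul, integral_const_mul]
      _ ≤ lam / 2 * (∫ y in dec ⁻¹' {m}, q y) + lam⁻¹ / 2 * V := by
          gcongr
          refine (setIntegral_le_integral hi (ae_of_all _ fun y => ?_)).trans hle
          have hqy : 0 < q y := signalDensity_pos ha 0 y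
          change 0 ≤ signalDensity 1 (s m) y ^ 2 / q y
          positivity
      _ = _ := by field_simp
  have hqsum : ∑ m, ∫ y in dec ⁻¹' {m}, q y = 1 := by
    rw [← integral_iUnion_fintype hD (fun i j hij => ?_) fun m => hqint.integrableOn,
      ← Set.preimage_iUnion, Set.iUnion_of_singleton, Set.preimage_univ, setIntegral_univ,
      integral_signalDensity ha]
    exact Disjoint.preimage _ (by simpa using hij)
  calc ∑ m, (noise ℓ).real {w | dec (s m + w) = m}
      ≤ ∑ m : Fin M, ((lam * ∫ y in dec ⁻¹' {m}, q y) / 2 + V / lam / 2) :=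
        Finset.sum_le_sum fun m _ => hterm m
    _ = lam / 2 + M * V / lam / 2 := by
        rw [Finset.sum_add_distrib, ← Finset.sum_div, ← Finset.mul_sum, hqsum]
        simp; ring
    _ = lam := by
        have : M * V = lam * lam := (Real.mul_self_sqrt (by positivity)).symm
        rw [this]; field_simp; ring

/-- If the rate `R = log M / ℓ` exceeds the affinity exponent by `κ`, every decoder errs with
probability at least `1 - exp (-κ / 2)`, whatever the block length. -/
lemma le_average_noise_ne {ℓ M : ℕ} (hℓ : 0 < ℓ) (hM : 0 < M) {S κ : ℝ} (hS : 0 ≤ S) (hκ : 0 ≤ κ)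
    (hrate : affinityExponent S + κ ≤ Real.log M / ℓ) {s : Fin M → Signal ℓ}
    (hs : ∀ m, ∑ t, ‖s m t‖ ^ 2 ≤ ℓ * S) {dec : Signal ℓ → Fin M} (hdec : Measurable dec) :
    ENNReal.ofReal (1 - Real.exp (-κ / 2)) ≤
      (M : ℝ≥0∞)⁻¹ * ∑ m, noise ℓ {w | dec (s m + w) ≠ m} := by
  have hMpos : (0 : ℝ) < M := by exact_mod_cast hM
  have hℓ1 : (1 : ℝ) ≤ ℓ := by exact_mod_cast hℓ
  have hmeas : ∀ m, MeasurableSet {w | dec (s m + w) = m} := fun m =>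
    (hdec.comp (measurable_const_add (s m))) (measurableSet_singleton m)
  have hsum : ∑ m, noise ℓ {w | dec (s m + w) ≠ m} =
      ENNReal.ofReal (M - ∑ m, (noise ℓ).real {w | dec (s m + w) = m}) := by
    have hcompl : ∀ m, noise ℓ {w | dec (s m + w) ≠ m} =
        ENNReal.ofReal (1 - (noise ℓ).real {w | dec (s m + w) = m}) := fun m => by
      rw [← probReal_compl_eq_one_sub (hmeas m), ofReal_measureReal]
      rfl
    simp_rw [hcompl]
    rw [← ENNReal.ofReal_sum_of_nonneg fun m _ => sub_nonneg.2 measureReal_le_one]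
    simp
  rw [hsum, ← ENNReal.ofReal_natCast, ← ENNReal.ofReal_inv_of_pos hMpos,
    ← ENNReal.ofReal_mul (by positivity)]
  refine ENNReal.ofReal_le_ofReal ?_
  have hV : Real.exp (ℓ * affinityExponent S) ≤ M * Real.exp (-κ) := by
    rw [le_div_iff₀ (by positivity)] at hrate
    calc Real.exp (ℓ * affinityExponent S) ≤ Real.exp (Real.log M + -κ) := by
          refine Real.exp_le_exp.2 ?_
          nlinarith
      _ = _ := by rw [Real.exp_add, Real.exp_log hMpos]
  have hroot : √(M * Real.exp (ℓ * affinityExponent S)) ≤ M * Real.exp (-κ / 2) := by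
    refine Real.sqrt_le_iff.2 ⟨by positivity, ?_⟩
    calc M * Real.exp (ℓ * affinityExponent S) ≤ M * (M * Real.exp (-κ)) := by gcongr
      _ = _ := by
        rw [mul_pow, ← Real.exp_nat_mul]; push_cast; ring_nf
  have hle := (sum_noise_real_le hS hs hdec).trans hroot
  rw [inv_mul_eq_div, le_div_iff₀ hMpos]
  linarith

/-! ### Lower bounds for the error of each access mode -/

lemma Codebook.sum_norm_smul_sq_le {n ℓ M : ℕ} {ρ : ℝ≥0} (C : Codebook n ℓ M ρ)
    (h : ChannelState n) (m : Fin M) (c : ℂ) :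
    ∑ t, ‖(c • C.word h m) t‖ ^ 2 ≤ ℓ * (ρ * ‖c‖ ^ 2) := by
  simp only [Pi.smul_apply, norm_smul, mul_pow]
  rw [← Finset.mul_sum]
  calc ‖c‖ ^ 2 * ∑ t, ‖C.word h m t‖ ^ 2 ≤ ‖c‖ ^ 2 * (ℓ * ρ) := by
        gcongr; exact C.power h m
    _ = _ := by ring

/-- Outage of a relay-assisted mode: the two superposed signals have total received power at most
`2 ρ (|h_ii|² + |h_ri|²)`, even if they add up coherently. -/
lemma RelayedCode.le_error {n ℓ : ℕ} {ρ : ℝ≥0} (C : RelayedCode n ℓ ρ) (i : Fin n)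
    (h : ChannelState n) (hℓ : 0 < ℓ) (hM : 0 < C.M) {S κ : ℝ} (hκ : 0 ≤ κ)
    (hS : 2 * ρ * (‖h.direct i‖ ^ 2 + ‖h.relayDest i‖ ^ 2) ≤ S)
    (hrate : affinityExponent S + κ ≤ Real.log C.M / ℓ) :
    ENNReal.ofReal (1 - Real.exp (-κ / 2)) ≤ C.error i h := by
  have hS0 : 0 ≤ S := le_trans (by positivity) hS
  refine le_average_noise_ne hℓ hM hS0 hκ hrate (fun m => ?_)
    (C.decoder.measurable_decode.comp measurable_prodMk_left)
  have h1 := C.source.sum_norm_smul_sq_le h m (h.direct i)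
  have h2 := C.relay.sum_norm_smul_sq_le h m (h.relayDest i)
  calc ∑ t, ‖(h.direct i • C.source.word h m + h.relayDest i • C.relay.word h m) t‖ ^ 2
      ≤ ∑ t, (2 * ‖(h.direct i • C.source.word h m) t‖ ^ 2 +
          2 * ‖(h.relayDest i • C.relay.word h m) t‖ ^ 2) := by
        refine Finset.sum_le_sum fun t _ => ?_
        rw [Pi.add_apply]
        have := norm_add_le ((h.direct i • C.source.word h m) t)
          ((h.relayDest i • C.relay.word h m) t)
        refine (pow_le_pow_left₀ (norm_nonneg _) this 2).trans ?_
        linarith [add_sq_le (a := ‖(h.direct i • C.source.word h m) t‖)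
          (b := ‖(h.relayDest i • C.relay.word h m) t‖)]
    _ ≤ 2 * (ℓ * (ρ * ‖h.direct i‖ ^ 2)) + 2 * (ℓ * (ρ * ‖h.relayDest i‖ ^ 2)) := by
        rw [Finset.sum_add_distrib, ← Finset.mul_sum, ← Finset.mul_sum]
        gcongr
    _ = ℓ * (2 * ρ * (‖h.direct i‖ ^ 2 + ‖h.relayDest i‖ ^ 2)) := by ring
    _ ≤ ℓ * S := by gcongr

/-- Averaging a function of a single message over all message tuples. -/
lemma average_pi_eval {ι : Type*} [Fintype ι] [DecidableEq ι] (M : ι → ℕ) (hM : ∀ i, 0 < M i)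
    (i : ι) (g : Fin (M i) → ℝ≥0∞) :
    (∏ j, (M j : ℝ≥0∞))⁻¹ * ∑ m : (∀ j, Fin (M j)), g (m i) = (M i : ℝ≥0∞)⁻¹ * ∑ k, g k := by
  set e := Equiv.piSplitAt i fun j => Fin (M j)
  set K := Fintype.card (∀ j : {j // j ≠ i}, Fin (M j)) with hK
  have hK0 : (K : ℝ≥0∞) ≠ 0 := by
    rw [hK, Fintype.card_pi, Nat.cast_ne_zero, Finset.prod_ne_zero_iff]
    exact fun j _ => by simpa using (hM j).ne'
  have hprod : ∏ j, (M j : ℝ≥0∞) = M i * K := by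
    have := Fintype.card_congr e
    rw [Fintype.card_pi, Fintype.card_prod] at this
    simp only [Fintype.card_fin] at this
    exact_mod_cast this
  have hsum : ∑ m : (∀ j, Fin (M j)), g (m i) = K * ∑ k, g k := by
    rw [← e.symm.sum_comp fun m => g (m i), Fintype.sum_prod_type, Finset.mul_sum]
    refine Finset.sum_congr rfl fun k _ => ?_
    simp [e, Equiv.piSplitAt, hK]
  rw [hprod, hsum, ENNReal.mul_inv (Or.inl (by simpa using (hM i).ne')) (Or.inl (by simp)),
    mul_assoc, ← mul_assoc (K : ℝ≥0∞)⁻¹, ENNReal.inv_mul_cancel hK0 (by simp), one_mul]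

/-- Outage of the non-relayed mode: one destination in outage is enough. -/
lemma le_directError {n ℓ : ℕ} {ρ : ℝ≥0} (C : Fin n → DirectCode n ℓ ρ) (i : Fin n)
    (h : ChannelState n) (hℓ : 0 < ℓ) (hM : ∀ j, 0 < (C j).M) {S κ : ℝ} (hκ : 0 ≤ κ)
    (hS : ρ * ‖h.direct i‖ ^ 2 ≤ S)
    (hrate : affinityExponent S + κ ≤ Real.log (C i).M / ℓ) :
    ENNReal.ofReal (1 - Real.exp (-κ / 2)) ≤ directError C h := by
  have hS0 : 0 ≤ S := le_trans (by positivity) hS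
  have hdec : Measurable fun y => (C i).decoder.decode (h, y) :=
    (C i).decoder.measurable_decode.comp measurable_prodMk_left
  have hlink := le_average_noise_ne hℓ (hM i) hS0 hκ hrate
    (s := fun m => h.direct i • (C i).source.word h m)
    (fun m => ((C i).source.sum_norm_smul_sq_le h m (h.direct i)).trans (by gcongr)) hdec
  refine hlink.trans ?_
  rw [← average_pi_eval (fun j => (C j).M) hM i]
  unfold directError
  gcongr with m
  have hE : MeasurableSet {w | (C i).decoder.decode
      (h, h.direct i • (C i).source.word h (m i) + w) ≠ m i} :=
    (hdec.comp (measurable_const_add _)) (measurableSet_singleton (m i)).compl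
  rw [← (measurePreserving_eval (fun _ : Fin n => noise ℓ) i).measure_preimage
    hE.nullMeasurableSet]
  exact measure_mono fun w hw => ⟨i, hw⟩

/-! ### The outage event -/

/-- If every access mode errs with probability at least `c` on an event of channel states, then the
mode selection cannot help on that event. -/
lemma Scheme.mul_le_errorProb {n : ℕ} {ρ : ℝ≥0} (S : Scheme n ρ) {A : Set (ChannelState n)}
    (hA : MeasurableSet A) {c : ℝ≥0∞} (hc : ∀ h ∈ A, ∀ k, c ≤ S.modeError h k) :
    c * fading n A ≤ S.errorProb := by
  unfold Scheme.errorProb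
  rw [← setLIntegral_const]
  refine (setLIntegral_mono' hA fun h hh => ?_).trans (setLIntegral_le_lintegral A _)
  calc c = ∑ k : Mode n, S.select h k * c := by
        rw [← Finset.sum_mul, ← tsum_fintype (L := .unconditional _), PMF.tsum_coe, one_mul]
    _ ≤ _ := by
        gcongr with k
        exact hc h hh k

/-- The outage event: the direct link of pair `i₀` has power gain at most `δ'`, every other link
towards a destination has power gain at most `δ`. -/
def outageEvent {n : ℕ} (i₀ : Fin n) (δ' δ : ℝ) : Set (ChannelState n) :=
  (Set.univ.pi fun i => Metric.closedBall 0 √(if i = i₀ then δ' else δ)) ×ˢ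
    ((Set.univ.pi fun _ => Metric.closedBall 0 √δ) ×ˢ Set.univ)

lemma measurableSet_outageEvent {n : ℕ} (i₀ : Fin n) (δ' δ : ℝ) :
    MeasurableSet (outageEvent i₀ δ' δ) :=
  (MeasurableSet.univ_pi fun _ => Metric.isClosed_closedBall.measurableSet).prod
    ((MeasurableSet.univ_pi fun _ => Metric.isClosed_closedBall.measurableSet).prod
      MeasurableSet.univ)

lemma norm_sq_le_of_mem_closedBall_sqrt {z : ℂ} {δ : ℝ} (h0 : 0 ≤ δ)
    (hz : z ∈ Metric.closedBall 0 √δ) : ‖z‖ ^ 2 ≤ δ := by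
  rw [mem_closedBall_zero_iff] at hz
  rw [← Real.sq_sqrt h0]
  gcongr

lemma le_fading_outageEvent {n : ℕ} (i₀ : Fin n) {δ' δ : ℝ} (h0' : 0 ≤ δ') (h1' : δ' ≤ 1)
    (h0 : 0 ≤ δ) (h1 : δ ≤ 1) :
    ENNReal.ofReal (δ' / Real.exp 1 * (δ / Real.exp 1) ^ (2 * n - 1)) ≤
      fading n (outageEvent i₀ δ' δ) := by
  have hn : 0 < n := i₀.pos
  unfold fading outageEvent
  rw [Measure.prod_prod, Measure.prod_prod, Measure.pi_pi, Measure.pi_pi, measure_univ, mul_one]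
  have hsplit : ∏ i : Fin n, (if i = i₀ then δ' else δ) / Real.exp 1 =
      δ' / Real.exp 1 * (δ / Real.exp 1) ^ (n - 1) := by
    rw [← Finset.mul_prod_erase _ _ (Finset.mem_univ i₀), if_pos rfl]
    congr 1
    rw [Finset.prod_congr rfl fun i hi => by rw [if_neg (Finset.ne_of_mem_erase hi)],
      Finset.prod_const, Finset.card_erase_of_mem (Finset.mem_univ _), Finset.card_univ,
      Fintype.card_fin]
  calc ENNReal.ofReal (δ' / Real.exp 1 * (δ / Real.exp 1) ^ (2 * n - 1))
      = (∏ i : Fin n, ENNReal.ofReal ((if i = i₀ then δ' else δ) / Real.exp 1)) *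
          ∏ _i : Fin n, ENNReal.ofReal (δ / Real.exp 1) := by
        rw [← ENNReal.ofReal_prod_of_nonneg, ← ENNReal.ofReal_prod_of_nonneg, hsplit,
          ← ENNReal.ofReal_mul (by positivity), Finset.prod_const, Finset.card_univ,
          Fintype.card_fin, mul_assoc, ← pow_add, show n - 1 + n = 2 * n - 1 by omega]
        · intros; positivity
        · intros; split_ifs <;> positivity
    _ ≤ _ := by
        gcongr with i _ i _
        · split_ifs
          · exact le_complexGaussian_closedBall h0' h1'
          · exact le_complexGaussian_closedBall h0 h1
        · exact le_complexGaussian_closedBall h0 h1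

/-! ### Growth of the rates and the diversity gain -/

lemma affinityExponent_le_three_mul {S : ℝ} (hS : 0 ≤ S) : affinityExponent S ≤ 3 * S := by
  have h1 : Real.log (1 + S) ≤ S := by
    have := Real.log_le_sub_one_of_pos (show 0 < 1 + S by positivity)
    linarith
  have h2 : 2 * S / (1 + 2 * S) ≤ 2 * S := div_le_self (by positivity) (by linarith)
  unfold affinityExponent
  linarith

lemma affinityExponent_le_log_add_one {S : ℝ} (hS : 0 ≤ S) :
    affinityExponent S ≤ Real.log (1 + S) + 1 := by
  have h2 : 2 * S / (1 + 2 * S) ≤ 1 := (div_le_one (by positivity)).2 (by linarith)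
  unfold affinityExponent
  linarith

lemma tendsto_coe_nnreal_atTop : Tendsto (fun ρ : ℝ≥0 => (ρ : ℝ)) atTop atTop :=
  NNReal.tendsto_coe_atTop.2 tendsto_id

lemma tendsto_log_nnreal_atTop : Tendsto (fun ρ : ℝ≥0 => Real.log ρ) atTop atTop :=
  Real.tendsto_log_atTop.comp tendsto_coe_nnreal_atTop

/-- A rate with multiplexing gain `r` eventually exceeds, by a positive constant, the affinity
exponent of a link whose signal-to-noise ratio grows with an exponent smaller than `r`. For `r = 0`
this is where the positive lower bound on the rate is needed. The factor `4` is the power gain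
available to two coherently superposed signals of equal power. -/
lemma eventually_affinityExponent_add_le {R : ℝ≥0 → ℝ} {r x R₀ : ℝ} (hr : 0 ≤ r)
    (hR : Tendsto (fun ρ => R ρ / Real.log ρ) atTop (𝓝 r)) (hR₀ : 0 < R₀)
    (hpos : ∀ᶠ ρ in atTop, R₀ ≤ R ρ) (hx : x < r) :
    ∀ᶠ ρ : ℝ≥0 in atTop, affinityExponent (4 * (ρ : ℝ) ^ x) + R₀ / 2 ≤ R ρ := by
  rcases hr.eq_or_lt with rfl | hr
  · have hlim : Tendsto (fun ρ : ℝ≥0 => (ρ : ℝ) ^ x) atTop (𝓝 0) := by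
      have := (tendsto_rpow_neg_atTop (neg_pos.2 hx)).comp tendsto_coe_nnreal_atTop
      simpa [Function.comp_def] using this
    filter_upwards [hpos, hlim.eventually_le_const (show 0 < R₀ / 24 by positivity)] with ρ h1 h2
    have := affinityExponent_le_three_mul (show 0 ≤ 4 * (ρ : ℝ) ^ x by positivity)
    linarith
  · set y := max x 0
    have hy : y < r := max_lt hx hr
    filter_upwards [hR.eventually_const_lt (show (y + r) / 2 < r by linarith),
      tendsto_coe_nnreal_atTop.eventually_gt_atTop 1,
      tendsto_log_nnreal_atTop.eventually_ge_atTop ((1 + Real.log 5 + R₀ / 2) / ((r - y) / 2))]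
      with ρ h1 h2 h3
    have hlog : 0 < Real.log ρ := Real.log_pos h2
    have hρ : (0 : ℝ) < ρ := by linarith
    rw [lt_div_iff₀ hlog] at h1
    rw [div_le_iff₀ (by linarith)] at h3
    have hxy : (ρ : ℝ) ^ x ≤ (ρ : ℝ) ^ y := Real.rpow_le_rpow_of_exponent_le h2.le (le_max_left _ _)
    have hy1 : 1 ≤ (ρ : ℝ) ^ y := Real.one_le_rpow h2.le (le_max_right _ _)
    have hle : Real.log (1 + 4 * (ρ : ℝ) ^ x) ≤ Real.log 5 + y * Real.log ρ := by
      rw [← Real.log_rpow hρ, ← Real.log_mul (by norm_num) (by positivity)]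
      exact Real.log_le_log (by positivity) (by linarith)
    have := affinityExponent_le_log_add_one (show 0 ≤ 4 * (ρ : ℝ) ^ x by positivity)
    nlinarith

/-- A code of positive rate has a message; note `Real.log 0 = 0`. -/
lemma pos_of_pos_log_div {M ℓ : ℕ} {R₀ : ℝ} (hR₀ : 0 < R₀) (h : R₀ ≤ Real.log M / ℓ) : 0 < M := by
  rcases Nat.eq_zero_or_pos M with rfl | hM
  · simp at h; linarith
  · exact hM

/-- All access modes are in outage simultaneously with probability at least of the order of
`ρ ^ (-(b + (2 n - 1) a))`, where `a` and `b` are slightly larger than `(1 - r)⁺` and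
`(1 - r / n)⁺`. -/
lemma HasMultiplexingGain.eventually_le_errorProb {n : ℕ} {S : ∀ ρ : ℝ≥0, Scheme n ρ} {r : ℝ}
    (hS : HasMultiplexingGain S r) (i₀ : Fin n) (hr : 0 ≤ r) {a b : ℝ} (ha : max (1 - r) 0 < a)
    (hb : max (1 - r / n) 0 < b) (hab : a ≤ b) :
    ∃ c : ℝ, 0 < c ∧ ∀ᶠ ρ : ℝ≥0 in atTop,
      ENNReal.ofReal (c * (ρ : ℝ) ^ (-(b + (2 * n - 1) * a))) ≤ (S ρ).errorProb := by
  have hn : 1 ≤ n := i₀.pos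
  obtain ⟨R₀, hR₀, hpos⟩ := hS.rate_pos
  have ha0 : 0 < a := (le_max_right _ _).trans_lt ha
  have hb0 : 0 < b := (le_max_right _ _).trans_lt hb
  have hκ : 0 < 1 - Real.exp (-(R₀ / 2) / 2) :=
    sub_pos.2 (Real.exp_lt_one_iff.2 (by linarith))
  refine ⟨(1 - Real.exp (-(R₀ / 2) / 2)) * (Real.exp 1)⁻¹ ^ (2 * n), by positivity, ?_⟩
  have hrel : ∀ᶠ ρ : ℝ≥0 in atTop, ∀ i,
      affinityExponent (4 * (ρ : ℝ) ^ (1 - a)) + R₀ / 2 ≤ (S ρ).relayedRate i :=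
    eventually_all.2 fun i => eventually_affinityExponent_add_le hr (hS.relayed i) hR₀
      (hpos.mono fun ρ h => (h i).1) (by linarith [le_max_left (1 - r) 0])
  have hdir : ∀ᶠ ρ : ℝ≥0 in atTop,
      affinityExponent (4 * (ρ : ℝ) ^ (1 - b)) + R₀ / 2 ≤ (S ρ).directRate i₀ :=
    eventually_affinityExponent_add_le (by positivity) (hS.direct i₀) hR₀
      (hpos.mono fun ρ h => (h i₀).2) (by linarith [le_max_left (1 - r / n) 0])
  filter_upwards [hpos, hrel, hdir, tendsto_coe_nnreal_atTop.eventually_gt_atTop 1]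
    with ρ h1 h2 h3 h4
  have hρ : (0 : ℝ) < ρ := by linarith
  set δ := (ρ : ℝ) ^ (-a) with hδ
  set δ' := (ρ : ℝ) ^ (-b) with hδ'
  have hδ0 : 0 < δ := by positivity
  have hδ0' : 0 < δ' := by positivity
  have hδ1 : δ ≤ 1 := Real.rpow_le_one_of_one_le_of_nonpos h4.le (by linarith)
  have hδ1' : δ' ≤ 1 := Real.rpow_le_one_of_one_le_of_nonpos h4.le (by linarith)
  have hδδ : δ' ≤ δ := Real.rpow_le_rpow_of_exponent_le h4.le (by linarith)
  have hρδ : (ρ : ℝ) * δ = (ρ : ℝ) ^ (1 - a) := by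
    rw [hδ, sub_eq_add_neg, Real.rpow_add hρ, Real.rpow_one]
  have hρδ' : (ρ : ℝ) * δ' = (ρ : ℝ) ^ (1 - b) := by
    rw [hδ', sub_eq_add_neg, Real.rpow_add hρ, Real.rpow_one]
  have hmodes : ∀ h ∈ outageEvent i₀ δ' δ, ∀ k,
      ENNReal.ofReal (1 - Real.exp (-(R₀ / 2) / 2)) ≤ (S ρ).modeError h k := by
    intro h hh k
    obtain ⟨hd, hrd, -⟩ := hh
    cases k with
    | none =>
      refine le_directError _ i₀ h (S ρ).ℓ_pos (fun j => pos_of_pos_log_div hR₀ (h1 j).2)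
        (by positivity) ?_ h3
      have hz : ‖h.direct i₀‖ ^ 2 ≤ δ' := norm_sq_le_of_mem_closedBall_sqrt hδ0'.le
        (by simpa [ChannelState.direct] using hd i₀ (Set.mem_univ _))
      rw [← hρδ']
      nlinarith
    | some i =>
      refine ((S ρ).relayed i).le_error i h (S ρ).ℓ_pos (pos_of_pos_log_div hR₀ (h1 i).1)
        (by positivity) ?_ (h2 i)
      have hz : ‖h.direct i‖ ^ 2 ≤ δ := by
        have := norm_sq_le_of_mem_closedBall_sqrt (by split_ifs <;> positivity)
          (hd i (Set.mem_univ _))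
        refine this.trans ?_
        split_ifs
        · exact hδδ
        · exact le_rfl
      have hz' : ‖h.relayDest i‖ ^ 2 ≤ δ :=
        norm_sq_le_of_mem_closedBall_sqrt hδ0.le (hrd i (Set.mem_univ _))
      rw [← hρδ]
      nlinarith
  refine le_trans ?_ ((S ρ).mul_le_errorProb (measurableSet_outageEvent i₀ δ' δ) hmodes)
  refine le_trans ?_ (mul_le_mul_right
    (le_fading_outageEvent i₀ hδ0'.le hδ1' hδ0.le hδ1) _)
  rw [← ENNReal.ofReal_mul hκ.le]
  refine ENNReal.ofReal_le_ofReal (le_of_eq ?_)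
  have hexp : (ρ : ℝ) ^ (-(b + (2 * n - 1) * a)) = δ' * δ ^ (2 * n - 1) := by
    rw [hδ, hδ', ← Real.rpow_mul_natCast hρ.le, ← Real.rpow_add hρ, Nat.cast_sub (by omega)]
    congr 1
    push_cast
    ring
  obtain ⟨k, hk⟩ : ∃ k, 2 * n = k + 1 := ⟨2 * n - 1, by omega⟩
  rw [hexp, hk, Nat.add_sub_cancel, mul_assoc]
  congr 1
  rw [div_eq_mul_inv, div_eq_mul_inv, mul_pow, pow_succ]
  ring

lemma HasMultiplexingGain.diversityGain_le {n : ℕ} {S : ∀ ρ : ℝ≥0, Scheme n ρ} {r : ℝ}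
    (hS : HasMultiplexingGain S r) (hn : 1 ≤ n) (hr : 0 ≤ r) :
    diversityGain S ≤
      ((max (1 - r / n) 0 + (2 * (n : ℝ) - 1) * max (1 - r) 0 : ℝ) : EReal) := by
  set D := max (1 - r / n) 0 + (2 * (n : ℝ) - 1) * max (1 - r) 0 with hD
  have hn1 : (1 : ℝ) ≤ n := by exact_mod_cast hn
  by_contra! hlt
  obtain ⟨D', hD1, hD2⟩ := EReal.lt_iff_exists_real_btwn.1 hlt
  refine hD2.not_ge ?_
  -- `2 n` links in outage and a constant factor each cost one `ε` in the exponent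
  set ε := (D' - D) / (2 * n + 1) with hε
  have hε0 : 0 < ε := div_pos (sub_pos.2 (EReal.coe_lt_coe_iff.1 hD1)) (by positivity)
  have hrn : r / n ≤ r := div_le_self hr hn1
  obtain ⟨c, hc, hev⟩ := hS.eventually_le_errorProb ⟨0, hn⟩ hr
    (a := max (1 - r) 0 + ε) (b := max (1 - r / n) 0 + ε) (by linarith) (by linarith) (by gcongr)
  refine limsup_le_of_le (by isBoundedDefault) ?_
  filter_upwards [hev, tendsto_coe_nnreal_atTop.eventually_gt_atTop 1,
    tendsto_log_nnreal_atTop.eventually_ge_atTop (-Real.log c / ε)] with ρ h1 h2 h3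
  have hρ : (0 : ℝ) < ρ := by linarith
  have hlog : 0 < Real.log ρ := Real.log_pos h2
  rw [div_le_iff₀ hε0] at h3
  have h4 := ENNReal.log_le_log h1
  rw [ENNReal.log_ofReal_of_pos (by positivity), Real.log_mul hc.ne' (by positivity),
    Real.log_rpow hρ] at h4
  rw [EReal.div_le_iff_le_mul (by exact_mod_cast hlog) (EReal.coe_ne_top _), ← EReal.coe_mul]
  rw [EReal.neg_le]
  refine le_trans ?_ h4
  rw [← EReal.coe_neg, EReal.coe_le_coe_iff]
  have : D' = D + (2 * n + 1) * ε := by rw [hε]; field_simp; ring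
  rw [this, hD]
  nlinarith

end SharedRelay

theorem theorem2 (n : ℕ) (hn : 1 ≤ n) (r : ℝ) (hr : 0 ≤ r) :
    SharedRelay.genieDMT n r ≤
        ((max (1 - r / n) 0 + (2 * (n : ℝ) - 1) * max (1 - r) 0 : ℝ) : EReal) ∧
      (r ≤ 1 → max (1 - r / n) 0 + (2 * (n : ℝ) - 1) * max (1 - r) 0 =
        2 * n - (2 * n - 1 + 1 / n) * r) ∧
      (1 < r → r ≤ n → max (1 - r / n) 0 + (2 * (n : ℝ) - 1) * max (1 - r) 0 =
        1 - r / n) := by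
  have hn1 : (1 : ℝ) ≤ n := by exact_mod_cast hn
  refine ⟨sSup_le ?_, fun h => ?_, fun h h' => ?_⟩
  · rintro d ⟨S, hS, rfl⟩
    exact hS.diversityGain_le hn hr
  · have : r / n ≤ 1 := (div_le_self hr hn1).trans h
    rw [max_eq_left (by linarith), max_eq_left (by linarith)]
    ring
  · have : r / n ≤ 1 := (div_le_one (by linarith)).2 h'
    rw [max_eq_left (by linarith), max_eq_right (by linarith)]
    ring
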